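/- Let $E$ and $F$ be three-dimensional complex vector spaces, let $V_6=E\oplus F$, and let $R=\mathbb{C}[\Lambda^3V_6]$ be the ring of polynomial functions on $\Lambda^3V_6$, i.e. the symmetric algebra of $(\Lambda^3V_6)^*=\Lambda^3(V_6^*)$. The group $G=\mathrm{SL}(E)\times\mathrm{SL}(F)$ acts on $V_6$ by $(g,h)(x,y)=(gx,hy)$, and hence on $\Lambda^3V_6$ and on $R$; let $R^{G}$ be the ring of invariants. Let $e_1,e_2,e_3$ be a basis of $E^*$ and $f_1,f_2,f_3$ a basis of $F^*$, so that together they form a basis of $V_6^*=E^*\oplus F^*$. Put $$\widehat e_1=e_2\wedge e_3,\qquad \widehat e_2=-e_1\wedge e_3,\qquad \widehat e_3=e_1\wedge e_2,$$ define $\widehat f_1,\widehat f_2,\widehat f_3\in\Lambda^2F^*$ in the same way from $f_1,f_2,f_3$, and consider the linear forms and $3\times 3$ matrices of linear forms on $\Lambda^3V_6$ given by $$L_E=e_1\wedge e_2\wedge e_3,\qquad L_F=-f_1\wedge f_2\wedge f_3,\qquad M_E=(\widehat e_i\wedge f_j)_{i,j},\qquad M_F=(e_i\wedge\widehat f_j)_{i,j}.$$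 Then $R^{G}$ is generated up to degree three by $$L_E,\quad L_F,\quad \operatorname{tr}(M_EM_F^t),\quad \det M_E,\quad \det M_F.$$ That is, these five polynomials are $G$-invariant, and a polynomial in $R$ of degree at most three is $G$-invariant if and only if it belongs to the $\mathbb{C}$-subalgebra of $R$ generated by these five polynomials. -/

import Mathlib

namespace TrivectorInvariants

noncomputable section

open Module

/-! ### Exterior products of linear forms -/

section Wedge

variable {M : Type*} [AddCommGroup M] [Module ℂ M]

/-- The exterior product `x ∧ y ∈ ⋀² M` of two vectors. -/
def wedge (x y : M) : ⋀[ℂ]^2 M := exteriorPower.ιMulti ℂ 2 ![x, y]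

/-- The exterior product `x ∧ y ∧ z ∈ ⋀³ M` of three vectors. -/
def wedge₃ (x y z : M) : ⋀[ℂ]^3 M := exteriorPower.ιMulti ℂ 3 ![x, y, z]

theorem ι_mem_range (x : M) :
    ExteriorAlgebra.ι ℂ x ∈ LinearMap.range (ExteriorAlgebra.ι ℂ (M := M)) := ⟨x, rfl⟩

/-- The exterior product `ω ∧ x ∈ ⋀³ M` of `ω ∈ ⋀² M` and `x ∈ M`. -/
def wedgeRight (ω : ⋀[ℂ]^2 M) (x : M) : ⋀[ℂ]^3 M :=
  ⟨(ω : ExteriorAlgebra ℂ M) * ExteriorAlgebra.ι ℂ x, by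
    have h := Submodule.mul_mem_mul ω.2 (ι_mem_range x)
    rwa [← pow_succ] at h⟩

/-- The exterior product `x ∧ ω ∈ ⋀³ M` of `x ∈ M` and `ω ∈ ⋀² M`. -/
def wedgeLeft (x : M) (ω : ⋀[ℂ]^2 M) : ⋀[ℂ]^3 M :=
  ⟨ExteriorAlgebra.ι ℂ x * (ω : ExteriorAlgebra ℂ M), by
    have h := Submodule.mul_mem_mul (ι_mem_range x) ω.2
    rwa [← pow_succ'] at h⟩

/-- For a triple `u₁, u₂, u₃` the triple `û₁ = u₂ ∧ u₃`, `û₂ = -u₁ ∧ u₃`, `û₃ = u₁ ∧ u₂`. -/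
def hat (u : Fin 3 → M) : Fin 3 → ⋀[ℂ]^2 M :=
  ![wedge (u 1) (u 2), -wedge (u 0) (u 2), wedge (u 0) (u 1)]

end Wedge

/-! ### Polynomial functions -/

section Polynomials

variable (W : Type*) [AddCommGroup W] [Module ℂ W]

/-- The ring `ℂ[W]` of polynomial functions on a finite-dimensional complex vector space `W`,
as the symmetric algebra of the dual space. -/
abbrev PolyRing : Type _ := SymmetricAlgebra ℂ (Dual ℂ W)

/-- The polynomials on `W` that are homogeneous of degree `d`: linear combinations of products of
`d` linear forms. -/
def homogeneousPart (d : ℕ) : Submodule ℂ (PolyRing W) :=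
  LinearMap.range (SymmetricAlgebra.ι ℂ (Dual ℂ W)) ^ d

/-- The polynomials on `W` of degree at most `d`. -/
def degreeLE (d : ℕ) : Submodule ℂ (PolyRing W) :=
  ⨆ k : Fin (d + 1), homogeneousPart W k

variable {W}

/-- Substitution `p ↦ p ∘ φ` of a linear endomorphism `φ` of `W` into polynomials on `W`. -/
def pullback (φ : W →ₗ[ℂ] W) : PolyRing W →ₐ[ℂ] PolyRing W :=
  SymmetricAlgebra.lift (SymmetricAlgebra.ι ℂ (Dual ℂ W) ∘ₗ φ.dualMap)

end Polynomials

/-! ### The group `SL(E) × SL(F)` and its invariants -/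

section Invariants

variable (E F : Type*) [AddCommGroup E] [Module ℂ E] [AddCommGroup F] [Module ℂ F]

/-- `⋀³ V₆` for `V₆ = E ⊕ F`. -/
abbrev Trivectors : Type _ := ⋀[ℂ]^3 (E × F)

variable {E F}

/-- The action of `(g, h) ∈ SL(E) × SL(F)` on `⋀³ (E ⊕ F)`, induced by `(x, y) ↦ (g x, h y)`. -/
def trivectorAction (g : SpecialLinearGroup ℂ E × SpecialLinearGroup ℂ F) :
    Trivectors E F →ₗ[ℂ] Trivectors E F :=
  exteriorPower.map 3
    (LinearMap.prodMap (g.1 : E ≃ₗ[ℂ] E).toLinearMap (g.2 : F ≃ₗ[ℂ] F).toLinearMap)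

/-- The action of `SL(E) × SL(F)` on polynomials on `⋀³ (E ⊕ F)`: `(g • p)(w) = p (g⁻¹ w)`. -/
def polyAction (g : SpecialLinearGroup ℂ E × SpecialLinearGroup ℂ F) :
    PolyRing (Trivectors E F) →ₐ[ℂ] PolyRing (Trivectors E F) :=
  pullback (trivectorAction g⁻¹)

variable (E F)

/-- The ring of `SL(E) × SL(F)`-invariant polynomials on `⋀³ (E ⊕ F)`. -/
def invariantRing : Subalgebra ℂ (PolyRing (Trivectors E F)) :=
  ⨅ g : SpecialLinearGroup ℂ E × SpecialLinearGroup ℂ F,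
    AlgHom.equalizer (polyAction g) (AlgHom.id ℂ _)

end Invariants

/-! ### The basic invariants

`e` and `f` are bases of `E*` and `F*`; via `V₆* = E* ⊕ F*` they form a basis of `V₆*`. -/

section Generators

variable {E F : Type*} [AddCommGroup E] [Module ℂ E] [AddCommGroup F] [Module ℂ F]

/-- A linear form on `E`, viewed as a linear form on `V₆ = E ⊕ F` that vanishes on `F`. -/
def extendE (a : Dual ℂ E) : Dual ℂ (E × F) := a ∘ₗ LinearMap.fst ℂ E F

/-- A linear form on `F`, viewed as a linear form on `V₆ = E ⊕ F` that vanishes on `E`. -/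
def extendF (b : Dual ℂ F) : Dual ℂ (E × F) := b ∘ₗ LinearMap.snd ℂ E F

/-- The linear polynomial on `⋀³ V₆` given by an element of `⋀³ (V₆*)`, through the canonical
identification `⋀³ (V₆*) = (⋀³ V₆)*`, `⟨a ∧ b ∧ c, x ∧ y ∧ z⟩ = det (pairings)`. -/
def linearForm (ω : ⋀[ℂ]^3 (Dual ℂ (E × F))) : PolyRing (Trivectors E F) :=
  SymmetricAlgebra.ι ℂ _ (exteriorPower.pairingDual ℂ (E × F) 3 ω)

variable (F) in
/-- `L_E = e₁ ∧ e₂ ∧ e₃`. -/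
def LE (e : Basis (Fin 3) ℂ (Dual ℂ E)) : PolyRing (Trivectors E F) :=
  linearForm (wedge₃ (extendE (e 0)) (extendE (e 1)) (extendE (e 2)))

variable (E) in
/-- `L_F = - f₁ ∧ f₂ ∧ f₃`. -/
def LF (f : Basis (Fin 3) ℂ (Dual ℂ F)) : PolyRing (Trivectors E F) :=
  linearForm (-wedge₃ (extendF (f 0)) (extendF (f 1)) (extendF (f 2)))

/-- `M_E = (ê_i ∧ f_j)`, a `3 × 3` matrix of linear forms. -/
def ME (e : Basis (Fin 3) ℂ (Dual ℂ E)) (f : Basis (Fin 3) ℂ (Dual ℂ F)) :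
    Matrix (Fin 3) (Fin 3) (PolyRing (Trivectors E F)) :=
  Matrix.of fun i j => linearForm (wedgeRight (hat (fun k => extendE (e k)) i) (extendF (f j)))

/-- `M_F = (e_i ∧ f̂_j)`, a `3 × 3` matrix of linear forms. -/
def MF (e : Basis (Fin 3) ℂ (Dual ℂ E)) (f : Basis (Fin 3) ℂ (Dual ℂ F)) :
    Matrix (Fin 3) (Fin 3) (PolyRing (Trivectors E F)) :=
  Matrix.of fun i j => linearForm (wedgeLeft (extendE (e i)) (hat (fun k => extendF (f k)) j))

/-- The five polynomials `L_E`, `L_F`, `tr (M_E M_Fᵗ)`, `det M_E`, `det M_F`. -/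
def basicInvariants (e : Basis (Fin 3) ℂ (Dual ℂ E)) (f : Basis (Fin 3) ℂ (Dual ℂ F)) :
    Set (PolyRing (Trivectors E F)) :=
  {LE F e, LF E f, (ME e f * (MF e f).transpose).trace, (ME e f).det, (MF e f).det}

end Generators

end

end TrivectorInvariants

/-! The linear forms on `⋀³ V₆` are spanned by `LE`, `LF` and the entries of `ME` and `MF`. If `e`
transforms by `P` and `f` by `Q`, both of determinant 1, then `LE` and `LF` are fixed, `ME` becomes
`P⁻ᵀ * ME * Qᵀ` and `MF` becomes `P * MF * Q⁻¹`. Invariance of the trace and of the two determinants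
can be read off.

Conversely, write an invariant `p` of degree at most three as a combination of monomials in these
forms. Diagonal matrices scale every monomial, so only monomials of weight zero are needed
(`mem_span_fixed`, `mem_span_weight_zero`). By `weight_zero_cases` these are `LE ^ a * LF ^ b` times
1, times `ME i j * MF i j`, or times a product of three entries of one matrix with distinct rows and
distinct columns. Summing over the 36 pairs of signed permutation matrices multiplies `p` by 36, and
turns the last factor of each such monomial into a multiple of 1, of the trace or of a determinant
(`permSum_ME_mul_MF`, `permSum_prod`). Hence `36 • p`, and so `p`, lies in the subalgebra.

Only finitely many group elements enter the converse, and the basic forms need only span: their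
independence is never used. -/

namespace TrivectorInvariants

noncomputable section

open Module

/-! ### The alternating form `(x, y, z) ↦ x ∧ y ∧ z` with values in the polynomial ring -/

section Tri

variable {E F : Type*} [AddCommGroup E] [Module ℂ E] [AddCommGroup F] [Module ℂ F]

/-- The linear polynomial `x ∧ y ∧ z` on `⋀³ (E ⊕ F)` as an alternating map. -/
def triMap : Dual ℂ (E × F) [⋀^Fin 3]→ₗ[ℂ] PolyRing (Trivectors E F) :=
  (SymmetricAlgebra.ι ℂ _ ∘ₗ exteriorPower.pairingDual ℂ (E × F) 3).compAlternatingMap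
    (exteriorPower.ιMulti ℂ 3)

/-- The linear polynomial `x ∧ y ∧ z` on `⋀³ (E ⊕ F)`. -/
def tri (x y z : Dual ℂ (E × F)) : PolyRing (Trivectors E F) := triMap ![x, y, z]

theorem triMap_apply (v : Fin 3 → Dual ℂ (E × F)) : triMap v = tri (v 0) (v 1) (v 2) := by
  rw [tri]; congr 1; ext i : 1; fin_cases i <;> rfl

variable (x x' y y' z z' : Dual ℂ (E × F)) (c : ℂ)

theorem tri_add_left : tri (x + x') y z = tri x y z + tri x' y z :=
  triMap.map_vecCons_add _ _ _

theorem tri_smul_left : tri (c • x) y z = c • tri x y z :=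
  triMap.map_vecCons_smul _ _ _

theorem tri_swap_left : tri y x z = -tri x y z := by
  have h := triMap.map_swap (v := ![x, y, z]) (i := 0) (j := 1) (by decide)
  rw [triMap_apply, triMap_apply] at h
  simpa [Equiv.swap_apply_of_ne_of_ne] using h

theorem tri_swap_right : tri x z y = -tri x y z := by
  have h := triMap.map_swap (v := ![x, y, z]) (i := 1) (j := 2) (by decide)
  rw [triMap_apply, triMap_apply] at h
  simpa [Equiv.swap_apply_of_ne_of_ne] using h

theorem tri_self_left : tri x x z = 0 :=
  triMap.map_eq_zero_of_eq _ (i := 0) (j := 1) rfl (by decide)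

theorem tri_self_right : tri z x x = 0 :=
  triMap.map_eq_zero_of_eq _ (i := 1) (j := 2) rfl (by decide)

theorem tri_add_middle : tri x (y + y') z = tri x y z + tri x y' z := by
  rw [tri_swap_left, tri_add_left, tri_swap_left x y, tri_swap_left x y']; ring

theorem tri_smul_middle : tri x (c • y) z = c • tri x y z := by
  rw [tri_swap_left, tri_smul_left, tri_swap_left x y]; simp

theorem tri_add_right : tri x y (z + z') = tri x y z + tri x y z' := by
  rw [tri_swap_right, tri_add_middle, tri_swap_right x z, tri_swap_right x z']; ring

theorem tri_smul_right : tri x y (c • z) = c • tri x y z := by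
  rw [tri_swap_right, tri_smul_middle, tri_swap_right x z]; simp

theorem linearForm_wedge₃ : linearForm (wedge₃ x y z) = tri x y z := rfl

theorem wedgeRight_wedge : wedgeRight (wedge x y) z = wedge₃ x y z := by
  apply Subtype.ext
  simp [wedgeRight, wedge, wedge₃, ExteriorAlgebra.ιMulti_apply, mul_assoc]

theorem wedgeRight_neg_wedge : wedgeRight (-wedge x y) z = -wedge₃ x y z := by
  apply Subtype.ext
  simp [wedgeRight, wedge, wedge₃, ExteriorAlgebra.ιMulti_apply, mul_assoc]

theorem wedgeLeft_wedge : wedgeLeft x (wedge y z) = wedge₃ x y z := by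
  apply Subtype.ext
  simp [wedgeLeft, wedge, wedge₃, ExteriorAlgebra.ιMulti_apply]

theorem wedgeLeft_neg_wedge : wedgeLeft x (-wedge y z) = -wedge₃ x y z := by
  apply Subtype.ext
  simp [wedgeLeft, wedge, wedge₃, ExteriorAlgebra.ιMulti_apply]

theorem linearForm_neg (ω : ⋀[ℂ]^3 (Dual ℂ (E × F))) : linearForm (-ω) = -linearForm ω := by
  simp [linearForm]

/-- Indices are cyclic in `Fin 3`: the minus sign in the second entry of `hat` is absorbed by
writing `-u₁ ∧ u₃` as `u₃ ∧ u₁`. This removes signs from all later formulas. -/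
theorem ME_apply (e : Basis (Fin 3) ℂ (Dual ℂ E)) (f : Basis (Fin 3) ℂ (Dual ℂ F)) (i j : Fin 3) :
    ME e f i j = tri (extendE (e (i + 1))) (extendE (e (i + 2))) (extendF (f j)) := by
  fin_cases i <;> simp [ME, hat, wedgeRight_wedge, wedgeRight_neg_wedge, linearForm_neg,
    linearForm_wedge₃]
  rw [tri_swap_left, neg_neg]

theorem MF_apply (e : Basis (Fin 3) ℂ (Dual ℂ E)) (f : Basis (Fin 3) ℂ (Dual ℂ F)) (i j : Fin 3) :
    MF e f i j = tri (extendE (e i)) (extendF (f (j + 1))) (extendF (f (j + 2))) := by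
  fin_cases j <;> simp [MF, hat, wedgeLeft_wedge, wedgeLeft_neg_wedge, linearForm_neg,
    linearForm_wedge₃]
  rw [tri_swap_right, neg_neg]

theorem LE_eq (e : Basis (Fin 3) ℂ (Dual ℂ E)) :
    LE F e = tri (extendE (e 0)) (extendE (e 1)) (extendE (e 2)) := rfl

theorem LF_eq (f : Basis (Fin 3) ℂ (Dual ℂ F)) :
    LF E f = -tri (extendF (f 0)) (extendF (f 1)) (extendF (f 2)) := by
  rw [LF, linearForm_neg]; rfl

/-- Two linear forms on an exterior power agree once they agree on decomposable trivectors, and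
there both sides are the same determinant of pairings. -/
theorem polyAction_tri (g : SpecialLinearGroup ℂ E × SpecialLinearGroup ℂ F) :
    polyAction g (tri x y z) =
      tri (x ∘ₗ LinearMap.prodMap (g⁻¹.1 : E ≃ₗ[ℂ] E).toLinearMap
          (g⁻¹.2 : F ≃ₗ[ℂ] F).toLinearMap)
        (y ∘ₗ LinearMap.prodMap (g⁻¹.1 : E ≃ₗ[ℂ] E).toLinearMap
          (g⁻¹.2 : F ≃ₗ[ℂ] F).toLinearMap)
        (z ∘ₗ LinearMap.prodMap (g⁻¹.1 : E ≃ₗ[ℂ] E).toLinearMap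
          (g⁻¹.2 : F ≃ₗ[ℂ] F).toLinearMap) := by
  simp only [tri, triMap, polyAction, pullback, LinearMap.compAlternatingMap_apply,
    LinearMap.comp_apply, SymmetricAlgebra.lift_ι_apply]
  congr 1
  apply exteriorPower.linearMap_ext
  ext v
  simp only [LinearMap.compAlternatingMap_apply, LinearMap.dualMap_apply, trivectorAction,
    exteriorPower.map_apply_ιMulti, exteriorPower.pairingDual_ιMulti_ιMulti]
  congr 1
  ext i j
  fin_cases j <;> rfl

theorem tri_sum_sum_left (u : Fin 3 → Dual ℂ (E × F)) (a b : Fin 3 → ℂ) :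
    tri (∑ k, a k • u k) (∑ k, b k • u k) z =
      (a 1 * b 2 - a 2 * b 1) • tri (u 1) (u 2) z + (a 2 * b 0 - a 0 * b 2) • tri (u 2) (u 0) z +
        (a 0 * b 1 - a 1 * b 0) • tri (u 0) (u 1) z := by
  simp only [Fin.sum_univ_three, tri_add_left, tri_add_middle, tri_smul_left, tri_smul_middle,
    tri_self_left]
  rw [tri_swap_left (u 0) (u 1), tri_swap_left (u 1) (u 2), tri_swap_left (u 2) (u 0)]
  module

theorem tri_sum_sum_right (u : Fin 3 → Dual ℂ (E × F)) (a b : Fin 3 → ℂ) :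
    tri z (∑ k, a k • u k) (∑ k, b k • u k) =
      (a 1 * b 2 - a 2 * b 1) • tri z (u 1) (u 2) + (a 2 * b 0 - a 0 * b 2) • tri z (u 2) (u 0) +
        (a 0 * b 1 - a 1 * b 0) • tri z (u 0) (u 1) := by
  simp only [Fin.sum_univ_three, tri_add_right, tri_add_middle, tri_smul_right, tri_smul_middle,
    tri_self_right]
  rw [tri_swap_right z (u 0) (u 1), tri_swap_right z (u 1) (u 2), tri_swap_right z (u 2) (u 0)]
  module

theorem tri_sum_right (u : Fin 3 → Dual ℂ (E × F)) (a : Fin 3 → ℂ) :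
    tri x y (∑ k, a k • u k) = ∑ k, a k • tri x y (u k) := by
  simp only [Fin.sum_univ_three, tri_add_right, tri_smul_right]

theorem tri_sum_left (u : Fin 3 → Dual ℂ (E × F)) (a : Fin 3 → ℂ) :
    tri (∑ k, a k • u k) x y = ∑ k, a k • tri (u k) x y := by
  simp only [Fin.sum_univ_three, tri_add_left, tri_smul_left]

theorem tri_sum_sum_sum (u : Fin 3 → Dual ℂ (E × F)) (P : Matrix (Fin 3) (Fin 3) ℂ) :
    tri (∑ k, P 0 k • u k) (∑ k, P 1 k • u k) (∑ k, P 2 k • u k) =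
      P.det • tri (u 0) (u 1) (u 2) := by
  rw [tri_sum_sum_left _ u (P 0) (P 1), tri_sum_right _ _ u (P 2), tri_sum_right _ _ u (P 2),
    tri_sum_right _ _ u (P 2)]
  have h₁ : tri (u 1) (u 2) (u 1) = 0 := by rw [tri_swap_right, tri_self_left, neg_zero]
  have h₂ : tri (u 2) (u 0) (u 2) = 0 := by rw [tri_swap_right, tri_self_left, neg_zero]
  have h₃ : tri (u 0) (u 1) (u 0) = 0 := by rw [tri_swap_right, tri_self_left, neg_zero]
  have h₄ : tri (u 1) (u 2) (u 0) = tri (u 0) (u 1) (u 2) := by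
    rw [tri_swap_right, tri_swap_left, neg_neg]
  have h₅ : tri (u 2) (u 0) (u 1) = tri (u 0) (u 1) (u 2) := by
    rw [tri_swap_left, tri_swap_right, neg_neg]
  simp only [Fin.sum_univ_three, tri_self_right, h₁, h₂, h₃, h₄, h₅, Matrix.det_fin_three]
  module

end Tri

/-! ### The action of `SL(E) × SL(F)` on the basic linear forms -/

section Action

open Matrix.SpecialLinearGroup
open scoped Matrix

variable {E F : Type*} [AddCommGroup E] [Module ℂ E] [AddCommGroup F] [Module ℂ F]

/-- Reflexivity of a finite-dimensional space: the basis dual to `e` lives in the double dual and is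
carried back to `E`. -/
theorem exists_predual_basis (hE : finrank ℂ E = 3) (e : Basis (Fin 3) ℂ (Dual ℂ E)) :
    ∃ b : Basis (Fin 3) ℂ E, ∀ i, b.coord i = e i := by
  have : Module.Finite ℂ E := Module.finite_of_finrank_pos (by omega)
  refine ⟨e.dualBasis.map (evalEquiv ℂ E).symm, fun i => ?_⟩
  refine (e.dualBasis.map (evalEquiv ℂ E).symm).ext fun j => ?_
  have h : e i ((evalEquiv ℂ E).symm (e.dualBasis j)) = e.dualBasis j (e i) := by
    rw [← Dual.eval_apply ℂ E, ← evalEquiv_apply, LinearEquiv.apply_symm_apply]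
  rw [Basis.coord_apply, Basis.repr_self, Basis.map_apply, h, Basis.dualBasis_apply_self,
    Finsupp.single_apply]
  simp [eq_comm]

/-- The elements of the basis `e` of `E*` transform under `g` through the rows of `P`. -/
def TransformsBy (e : Basis (Fin 3) ℂ (Dual ℂ E)) (g : SpecialLinearGroup ℂ E)
    (P : Matrix.SpecialLinearGroup (Fin 3) ℂ) : Prop :=
  ∀ i, e i ∘ₗ (g⁻¹ : E ≃ₗ[ℂ] E).toLinearMap = ∑ k, P i k • e k

/-- Polynomials are acted on through `g⁻¹`, so the element to take is the inverse of the map with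
matrix `P`; then `P` itself appears. -/
theorem transformsBy_toLin_equiv {e : Basis (Fin 3) ℂ (Dual ℂ E)} {b : Basis (Fin 3) ℂ E}
    (hb : ∀ i, b.coord i = e i) (P : Matrix.SpecialLinearGroup (Fin 3) ℂ) :
    TransformsBy e (toLin_equiv b P)⁻¹ P := by
  intro i
  have h : (((toLin_equiv b P)⁻¹ : SpecialLinearGroup ℂ E)⁻¹ : E ≃ₗ[ℂ] E).toLinearMap =
      Matrix.toLin b b P := by
    rw [← toLin_equiv.toLinearMap_eq, ← SpecialLinearGroup.coe_inv, inv_inv]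
  refine b.ext fun j => ?_
  rw [LinearMap.comp_apply, h, Matrix.toLin_self, ← hb]
  simp [← hb, Finsupp.single_apply, eq_comm]

theorem exists_transformsBy (hE : finrank ℂ E = 3) (e : Basis (Fin 3) ℂ (Dual ℂ E))
    (P : Matrix.SpecialLinearGroup (Fin 3) ℂ) : ∃ g, TransformsBy e g P := by
  obtain ⟨b, hb⟩ := exists_predual_basis hE e
  exact ⟨_, transformsBy_toLin_equiv hb P⟩

theorem exists_matrix_transformsBy (hE : finrank ℂ E = 3) (e : Basis (Fin 3) ℂ (Dual ℂ E))
    (g : SpecialLinearGroup ℂ E) : ∃ P, TransformsBy e g P := by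
  obtain ⟨b, hb⟩ := exists_predual_basis hE e
  refine ⟨(toLin_equiv b).symm g⁻¹, ?_⟩
  simpa using transformsBy_toLin_equiv hb ((toLin_equiv b).symm g⁻¹)

variable {e : Basis (Fin 3) ℂ (Dual ℂ E)} {f : Basis (Fin 3) ℂ (Dual ℂ F)}
  {g : SpecialLinearGroup ℂ E} {h : SpecialLinearGroup ℂ F}
  {P Q : Matrix.SpecialLinearGroup (Fin 3) ℂ}

theorem TransformsBy.extendE_comp (hP : TransformsBy e g P) (i : Fin 3) :
    extendE (e i) ∘ₗ LinearMap.prodMap (((g, h) : _ × _)⁻¹.1 : E ≃ₗ[ℂ] E).toLinearMap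
      (((g, h) : _ × _)⁻¹.2 : F ≃ₗ[ℂ] F).toLinearMap = ∑ k, P i k • extendE (F := F) (e k) := by
  ext x
  · simpa [extendE] using LinearMap.congr_fun (hP i) x
  · simp [extendE]

theorem TransformsBy.extendF_comp (hQ : TransformsBy f h Q) (i : Fin 3) :
    extendF (f i) ∘ₗ LinearMap.prodMap (((g, h) : _ × _)⁻¹.1 : E ≃ₗ[ℂ] E).toLinearMap
      (((g, h) : _ × _)⁻¹.2 : F ≃ₗ[ℂ] F).toLinearMap = ∑ k, Q i k • extendF (E := E) (f k) := by
  ext x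
  · simp [extendF]
  · simpa [extendF] using LinearMap.congr_fun (hQ i) x

theorem TransformsBy.polyAction_LE (hP : TransformsBy e g P) :
    polyAction (g, h) (LE F e) = LE F e := by
  rw [LE_eq, polyAction_tri, hP.extendE_comp, hP.extendE_comp, hP.extendE_comp,
    tri_sum_sum_sum, P.det_coe, one_smul]

theorem TransformsBy.polyAction_LF (hQ : TransformsBy f h Q) :
    polyAction (g, h) (LF E f) = LF E f := by
  rw [LF_eq, map_neg, polyAction_tri, hQ.extendF_comp, hQ.extendF_comp, hQ.extendF_comp,
    tri_sum_sum_sum, Q.det_coe, one_smul]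

/-- The determinant is 1, so the inverse is the adjugate, and cyclic indexing makes the cofactors
sign-free. This turns the minors acting on `e (i + 1) ∧ e (i + 2)` into entries of `P⁻¹`. -/
theorem inv_apply_eq_minor (k i : Fin 3) :
    P⁻¹ k i = P (i + 1) (k + 1) * P (i + 2) (k + 2) - P (i + 1) (k + 2) * P (i + 2) (k + 1) := by
  rw [show P⁻¹ k i = P.1.adjugate k i from congr_fun₂ (coe_inv P) k i]
  fin_cases k <;> fin_cases i <;>
    simp [Matrix.adjugate_fin_three] <;> ring

theorem TransformsBy.polyAction_ME (hP : TransformsBy e g P) (hQ : TransformsBy f h Q)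
    (i j : Fin 3) :
    polyAction (g, h) (ME e f i j) = ∑ k, ∑ l, (P⁻¹ k i * Q j l) • ME e f k l := by
  rw [ME_apply, polyAction_tri, hP.extendE_comp, hP.extendE_comp, hQ.extendF_comp]
  rw [tri_sum_sum_left _ _ (P (i + 1)) (P (i + 2)), tri_sum_right _ _ _ (Q j),
    tri_sum_right _ _ _ (Q j), tri_sum_right _ _ _ (Q j)]
  rw [Fin.sum_univ_three (fun k => ∑ l, (P⁻¹ k i * Q j l) • ME e f k l)]
  simp only [ME_apply, mul_smul, ← Finset.smul_sum, inv_apply_eq_minor]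
  rfl

theorem TransformsBy.polyAction_MF (hP : TransformsBy e g P) (hQ : TransformsBy f h Q)
    (i j : Fin 3) :
    polyAction (g, h) (MF e f i j) = ∑ k, ∑ l, (P i k * Q⁻¹ l j) • MF e f k l := by
  rw [MF_apply, polyAction_tri, hP.extendE_comp, hQ.extendF_comp, hQ.extendF_comp]
  rw [tri_sum_sum_right _ _ (Q (j + 1)) (Q (j + 2)), tri_sum_left _ _ _ (P i),
    tri_sum_left _ _ _ (P i), tri_sum_left _ _ _ (P i)]
  rw [Finset.sum_comm, Fin.sum_univ_three (fun l => ∑ k, (P i k * Q⁻¹ l j) • MF e f k l)]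
  simp only [MF_apply, mul_comm (P i _), mul_smul, ← Finset.smul_sum, inv_apply_eq_minor]
  rfl

theorem TransformsBy.mapMatrix_ME (hP : TransformsBy e g P) (hQ : TransformsBy f h Q) :
    (polyAction (g, h)).mapMatrix (ME e f) =
      ((P⁻¹).1.map (algebraMap ℂ _))ᵀ * ME e f *
        (Q.1.map (algebraMap ℂ _))ᵀ := by
  ext i j
  rw [AlgHom.mapMatrix_apply, Matrix.map_apply, hP.polyAction_ME hQ, Finset.sum_comm]
  simp only [Matrix.mul_apply, Matrix.transpose_apply, Matrix.map_apply, Finset.sum_mul,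
    Algebra.smul_def, map_mul]
  refine Finset.sum_congr rfl fun l _ => Finset.sum_congr rfl fun k _ => ?_
  ring

theorem TransformsBy.mapMatrix_MF (hP : TransformsBy e g P) (hQ : TransformsBy f h Q) :
    (polyAction (g, h)).mapMatrix (MF e f) =
      P.1.map (algebraMap ℂ _) * MF e f * (Q⁻¹).1.map (algebraMap ℂ _) := by
  ext i j
  rw [AlgHom.mapMatrix_apply, Matrix.map_apply, hP.polyAction_MF hQ, Finset.sum_comm]
  simp only [Matrix.mul_apply, Matrix.map_apply, Finset.sum_mul, Algebra.smul_def, map_mul]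
  refine Finset.sum_congr rfl fun l _ => Finset.sum_congr rfl fun k _ => ?_
  ring

theorem det_map_algebraMap (A : Type*) [CommRing A] [Algebra ℂ A]
    (P : Matrix.SpecialLinearGroup (Fin 3) ℂ) : (P.1.map (algebraMap ℂ A)).det = 1 := by
  rw [← RingHom.mapMatrix_apply, ← RingHom.map_det, P.2, map_one]

theorem map_algebraMap_mul_inv (A : Type*) [CommRing A] [Algebra ℂ A]
    (P : Matrix.SpecialLinearGroup (Fin 3) ℂ) :
    (P⁻¹).1.map (algebraMap ℂ A) * P.1.map (algebraMap ℂ A) = 1 := by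
  rw [← Matrix.map_mul, ← coe_mul, inv_mul_cancel]
  simp

theorem basicInvariants_subset_invariantRing (hE : finrank ℂ E = 3) (hF : finrank ℂ F = 3)
    (e : Basis (Fin 3) ℂ (Dual ℂ E)) (f : Basis (Fin 3) ℂ (Dual ℂ F)) :
    basicInvariants e f ⊆ invariantRing E F := by
  intro p hp
  rw [SetLike.mem_coe, invariantRing, Algebra.mem_iInf]
  rintro ⟨g, h⟩
  obtain ⟨P, hP⟩ := exists_matrix_transformsBy hE e g
  obtain ⟨Q, hQ⟩ := exists_matrix_transformsBy hF f h
  rw [AlgHom.mem_equalizer, AlgHom.id_apply]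
  have hME := hP.mapMatrix_ME hQ
  have hMF := hP.mapMatrix_MF hQ
  have hPP := map_algebraMap_mul_inv (PolyRing (Trivectors E F)) P
  have hQQ := map_algebraMap_mul_inv (PolyRing (Trivectors E F)) Q
  have hdet := det_map_algebraMap (PolyRing (Trivectors E F))
  rcases hp with rfl | rfl | rfl | rfl | rfl
  · exact hP.polyAction_LE
  · exact hQ.polyAction_LF
  · have hmap : (polyAction (g, h)).mapMatrix (MF e f)ᵀ =
        ((polyAction (g, h)).mapMatrix (MF e f))ᵀ := rfl
    -- The product becomes `P⁻ᵀ * ME * Qᵀ * Q⁻ᵀ * MFᵀ * Pᵀ`: the `Q` factors cancel in the middle,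
    -- the `P` factors after a cyclic shift under the trace.
    rw [AddMonoidHom.map_trace, ← AlgHom.mapMatrix_apply, map_mul, hmap, hME, hMF,
      Matrix.transpose_mul, Matrix.transpose_mul, Matrix.mul_assoc, ← Matrix.mul_assoc (_ᵀ) (_ᵀ) _,
      ← Matrix.transpose_mul, hQQ, Matrix.transpose_one, Matrix.one_mul, Matrix.mul_assoc,
      Matrix.trace_mul_comm, Matrix.mul_assoc, Matrix.mul_assoc, ← Matrix.transpose_mul, hPP,
      Matrix.transpose_one, Matrix.mul_one]
  · rw [AlgHom.map_det, hME, Matrix.det_mul, Matrix.det_mul, Matrix.det_transpose,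
      Matrix.det_transpose, hdet, hdet, one_mul, mul_one]
  · rw [AlgHom.map_det, hMF, Matrix.det_mul, Matrix.det_mul, hdet, hdet, one_mul, mul_one]

end Action

/-! ### Monomials in the basic linear forms -/

section Monomials

variable {E F : Type*} [AddCommGroup E] [Module ℂ E] [AddCommGroup F] [Module ℂ F]

/-- The span of `L_E`, `L_F`, `M_E`, `M_F`. -/
def basicForms (e : Basis (Fin 3) ℂ (Dual ℂ E)) (f : Basis (Fin 3) ℂ (Dual ℂ F)) :
    Submodule ℂ (PolyRing (Trivectors E F)) :=
  Submodule.span ℂ ({LE F e, LF E f} ∪ Set.range (fun x : Fin 3 × Fin 3 => ME e f x.1 x.2) ∪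
    Set.range (fun x : Fin 3 × Fin 3 => MF e f x.1 x.2))

variable (e : Basis (Fin 3) ℂ (Dual ℂ E)) (f : Basis (Fin 3) ℂ (Dual ℂ F))

theorem LE_mem_basicForms : LE F e ∈ basicForms e f :=
  Submodule.subset_span (by simp)

theorem LF_mem_basicForms : LF E f ∈ basicForms e f :=
  Submodule.subset_span (by simp)

theorem ME_mem_basicForms (i j : Fin 3) : ME e f i j ∈ basicForms e f :=
  Submodule.subset_span (Or.inl (Or.inr ⟨(i, j), rfl⟩))

theorem MF_mem_basicForms (i j : Fin 3) : MF e f i j ∈ basicForms e f :=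
  Submodule.subset_span (Or.inr ⟨(i, j), rfl⟩)

/-- A submodule containing the three products `u (i + 1) ∧ u (i + 2) ∧ z` contains all
`u i ∧ u j ∧ z`. -/
theorem tri_mem_of_left {N : Submodule ℂ (PolyRing (Trivectors E F))}
    {u : Fin 3 → Dual ℂ (E × F)} {z : Dual ℂ (E × F)}
    (h : ∀ i, tri (u (i + 1)) (u (i + 2)) z ∈ N) (i j : Fin 3) : tri (u i) (u j) z ∈ N := by
  have hadd : ∀ k : Fin 3, k + 2 + 1 = k ∧ k + 2 + 2 = k + 1 := by decide
  have hij : j = i ∨ j = i + 1 ∨ i = j + 1 := by decide +revert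
  rcases hij with rfl | rfl | rfl
  · rw [tri_self_left]; exact N.zero_mem
  · have h' := h (i + 2)
    rwa [(hadd i).1, (hadd i).2] at h'
  · have h' := h (j + 2)
    rw [(hadd j).1, (hadd j).2] at h'
    rw [tri_swap_left]; exact N.neg_mem h'

theorem tri_mem_of_right {N : Submodule ℂ (PolyRing (Trivectors E F))}
    {u : Fin 3 → Dual ℂ (E × F)} {z : Dual ℂ (E × F)}
    (h : ∀ i, tri z (u (i + 1)) (u (i + 2)) ∈ N) (i j : Fin 3) : tri z (u i) (u j) ∈ N := by
  have h' : ∀ i j, tri (u i) (u j) z = tri z (u i) (u j) := fun i j => by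
    rw [tri_swap_right, tri_swap_left, neg_neg]
  rw [← h']
  exact tri_mem_of_left (fun i => by rw [h']; exact h i) i j

theorem tri_mem_of_all {N : Submodule ℂ (PolyRing (Trivectors E F))}
    {u : Fin 3 → Dual ℂ (E × F)} (h : tri (u 0) (u 1) (u 2) ∈ N) (i j k : Fin 3) :
    tri (u i) (u j) (u k) ∈ N := by
  refine tri_mem_of_left (fun i => ?_) i j
  have hik : k = i ∨ k = i + 1 ∨ k = i + 2 := by decide +revert
  rcases hik with rfl | rfl | rfl
  · fin_cases k
    · change tri (u 1) (u 2) (u 0) ∈ N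
      rwa [tri_swap_right, tri_swap_left, neg_neg]
    · change tri (u 2) (u 0) (u 1) ∈ N
      rwa [tri_swap_left, tri_swap_right, neg_neg]
    · exact h
  · rw [tri_swap_right, tri_self_left]; exact N.neg_mem N.zero_mem
  · rw [tri_self_right]; exact N.zero_mem

theorem tri_mem_basicForms (x y z : Fin 3 ⊕ Fin 3) :
    tri (Sum.elim (fun i => extendE (e i)) (fun j => extendF (f j)) x)
      (Sum.elim (fun i => extendE (e i)) (fun j => extendF (f j)) y)
      (Sum.elim (fun i => extendE (e i)) (fun j => extendF (f j)) z) ∈ basicForms e f := by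
  have hEEE := tri_mem_of_all (N := basicForms e f) (u := fun i => extendE (e i))
    (LE_mem_basicForms e f)
  have hFFF := tri_mem_of_all (N := basicForms e f) (u := fun i => extendF (f i)) (by
    have h := LF_mem_basicForms e f
    rwa [LF_eq, Submodule.neg_mem_iff] at h)
  have hEEF : ∀ i j k, tri (extendE (e i)) (extendE (e j)) (extendF (f k)) ∈ basicForms e f :=
    fun i j k => tri_mem_of_left (u := fun i => extendE (e i)) (fun i => by
      have h := ME_mem_basicForms e f i k
      rwa [ME_apply] at h) i j
  have hEFF : ∀ i j k, tri (extendE (e i)) (extendF (f j)) (extendF (f k)) ∈ basicForms e f :=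
    fun i j k => tri_mem_of_right (u := fun i => extendF (f i)) (fun j => by
      have h := MF_mem_basicForms e f i j
      rwa [MF_apply] at h) j k
  rcases x with x | x <;> rcases y with y | y <;> rcases z with z | z <;>
    simp only [Sum.elim_inl, Sum.elim_inr]
  · exact hEEE _ _ _
  · exact hEEF _ _ _
  · rw [tri_swap_right, Submodule.neg_mem_iff]; exact hEEF _ _ _
  · exact hEFF _ _ _
  · rw [tri_swap_left, tri_swap_right, neg_neg]; exact hEEF _ _ _
  · rw [tri_swap_left, Submodule.neg_mem_iff]; exact hEFF _ _ _
  · rw [tri_swap_right, tri_swap_left, neg_neg]; exact hEFF _ _ _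
  · exact hFFF _ _ _

/-- The coordinate forms of the induced basis of the exterior power span its dual, and each is the
image of a wedge of coordinate forms of `b`. -/
theorem pairingDual_surjective {V ι : Type*} [AddCommGroup V] [Module ℂ V] [Finite ι]
    (b : Basis ι ℂ V) (n : ℕ) :
    Function.Surjective (exteriorPower.pairingDual ℂ V n) := by
  classical
  let : LinearOrder ι := linearOrderOfSTO WellOrderingRel
  have : Fintype ι := Fintype.ofFinite ι
  rw [← LinearMap.range_eq_top, ← top_le_iff, ← (b.exteriorPower n).dualBasis.span_eq,
    Submodule.span_le]
  rintro _ ⟨s, rfl⟩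
  refine ⟨exteriorPower.ιMulti_family ℂ n b.coord s, ?_⟩
  rw [Basis.coe_dualBasis, exteriorPower.basis_coord]
  rfl

theorem range_ι_le_basicForms (hE : finrank ℂ E = 3) (hF : finrank ℂ F = 3) :
    LinearMap.range (SymmetricAlgebra.ι ℂ (Dual ℂ (Trivectors E F))) ≤ basicForms e f := by
  obtain ⟨b, hb⟩ := exists_predual_basis hE e
  obtain ⟨c, hc⟩ := exists_predual_basis hF f
  let d := b.prod c
  have hd : ∀ i, d.coord i = Sum.elim (fun i => extendE (e i)) (fun j => extendF (f j)) i := by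
    rintro (i | i)
    · ext x <;> simp [d, extendE, ← hb]
    · ext x <;> simp [d, extendF, ← hc]
  have hspan : Submodule.span ℂ (Set.range d.coord) = ⊤ := by
    rw [← d.coe_dualBasis, d.dualBasis.span_eq]
  have hpair := pairingDual_surjective d 3
  rintro _ ⟨φ, rfl⟩
  obtain ⟨ω, rfl⟩ := hpair φ
  suffices h : (⊤ : Submodule ℂ _) ≤ (basicForms e f).comap
      (SymmetricAlgebra.ι ℂ _ ∘ₗ exteriorPower.pairingDual ℂ (E × F) 3) from
    h (Submodule.mem_top (x := ω))
  rw [← exteriorPower.ιMulti_span_of_span ℂ 3 _ hspan, Submodule.span_le]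
  rintro _ ⟨v, hv, rfl⟩
  have hv' : ∀ i, ∃ k, d.coord k = v i := fun i => hv ⟨i, rfl⟩
  choose k hk using hv'
  change triMap v ∈ basicForms e f
  rw [triMap_apply, ← hk, ← hk, ← hk, hd, hd, hd]
  exact tri_mem_basicForms e f _ _ _

/-- A monomial in the entries of `L_E`, `L_F`, `M_E` and `M_F`. -/
def monomial (a b : ℕ) (s t : List (Fin 3 × Fin 3)) : PolyRing (Trivectors E F) :=
  LE F e ^ a * LF E f ^ b * (s.map fun x => ME e f x.1 x.2).prod *
    (t.map fun x => MF e f x.1 x.2).prod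

/-- The monomials of degree `n`. -/
def monomials (n : ℕ) : Set (PolyRing (Trivectors E F)) :=
  {p | ∃ a b s t, a + b + s.length + t.length = n ∧ monomial e f a b s t = p}

theorem homogeneousPart_le_span_monomials (hE : finrank ℂ E = 3) (hF : finrank ℂ F = 3) (n : ℕ) :
    homogeneousPart (Trivectors E F) n ≤ Submodule.span ℂ (monomials e f n) := by
  induction n with
  | zero =>
    rw [homogeneousPart, pow_zero, Submodule.one_eq_span, Submodule.span_le,
      Set.singleton_subset_iff]
    exact Submodule.subset_span ⟨0, 0, [], [], rfl, by simp [monomial]⟩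
  | succ n ih =>
    rw [homogeneousPart, pow_succ']
    refine (mul_le_mul' (range_ι_le_basicForms e f hE hF) ih).trans ?_
    rw [basicForms, Submodule.span_mul_span, Submodule.span_le]
    rintro _ ⟨x, hx, _, ⟨a, b, s, t, hn, rfl⟩, rfl⟩
    apply Submodule.subset_span
    rcases hx with ((rfl | rfl) | ⟨y, rfl⟩) | ⟨y, rfl⟩
    · exact ⟨a + 1, b, s, t, by omega, by simp only [monomial]; ring⟩
    · exact ⟨a, b + 1, s, t, by omega, by simp only [monomial]; ring⟩
    · exact ⟨a, b, y :: s, t, by rw [List.length_cons]; omega, by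
        simp only [monomial, List.map_cons, List.prod_cons]; ring⟩
    · exact ⟨a, b, s, y :: t, by rw [List.length_cons]; omega, by
        simp only [monomial, List.map_cons, List.prod_cons]; ring⟩

theorem degreeLE_le_span_monomials (hE : finrank ℂ E = 3) (hF : finrank ℂ F = 3) (n : ℕ) :
    degreeLE (Trivectors E F) n ≤ Submodule.span ℂ (⋃ k ≤ n, monomials e f k) :=
  iSup_le fun k => (homogeneousPart_le_span_monomials e f hE hF k).trans
    (Submodule.span_mono (Set.subset_biUnion_of_mem (u := monomials e f)
      (show (k : ℕ) ≤ n by omega)))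

end Monomials

/-! ### Fixed vectors of diagonalizable operators -/

theorem mem_span_fixed {V : Type*} [AddCommGroup V] [Module ℂ V] (φ : End ℂ V) {S : Set V}
    (hS : ∀ s ∈ S, ∃ c : ℂ, φ s = c • s) {v : V} (hv : v ∈ Submodule.span ℂ S) (hφ : φ v = v) :
    v ∈ Submodule.span ℂ {s ∈ S | φ s = s} := by
  have hle : Submodule.span ℂ S ≤ Submodule.span ℂ {s ∈ S | φ s = s} ⊔
      ⨆ (μ : ℂ) (_ : μ ≠ 1), φ.eigenspace μ := by
    rw [Submodule.span_le]
    intro s hs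
    obtain ⟨c, hc⟩ := hS s hs
    by_cases hc1 : c = 1
    · exact Submodule.mem_sup_left (Submodule.subset_span ⟨hs, by rw [hc, hc1, one_smul]⟩)
    · exact Submodule.mem_sup_right (Submodule.mem_iSup_of_mem c
        (Submodule.mem_iSup_of_mem hc1 (End.mem_eigenspace_iff.2 hc)))
  -- Here `x` collects the fixed generators and `y` those with other eigenvalues. As `y` is then
  -- itself fixed, independence of eigenspaces forces it to vanish.
  obtain ⟨x, hx, y, hy, rfl⟩ := Submodule.mem_sup.1 (hle hv)
  have hx1 : x ∈ φ.eigenspace 1 := by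
    refine (Submodule.span_le (p := φ.eigenspace 1)).2 ?_ hx
    rintro s ⟨-, hs⟩
    exact End.mem_eigenspace_iff.2 (by rw [hs, one_smul])
  have hy1 : y ∈ φ.eigenspace 1 := by
    have h := Submodule.sub_mem _ (End.mem_eigenspace_iff.2 (hφ.trans (one_smul ℂ _).symm)) hx1
    rwa [add_sub_cancel_left] at h
  have hy0 : y = 0 := Submodule.disjoint_def.1 (φ.eigenspaces_iSupIndep 1) y hy1 hy
  rwa [hy0, add_zero]

/-! ### Diagonal matrices -/

section Torus

variable {E F : Type*} [AddCommGroup E] [Module ℂ E] [AddCommGroup F] [Module ℂ F]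

/-- The diagonal matrix with entries `2 ^ u i`. -/
def torus (u : Fin 3 → ℤ) (hu : ∑ i, u i = 0) : Matrix.SpecialLinearGroup (Fin 3) ℂ :=
  ⟨Matrix.diagonal fun i => 2 ^ u i, by
    rw [Matrix.det_diagonal, Fin.prod_univ_three, ← zpow_add₀ two_ne_zero,
      ← zpow_add₀ two_ne_zero, ← Fin.sum_univ_three, hu, zpow_zero]⟩

theorem torus_apply (u : Fin 3 → ℤ) (hu : ∑ i, u i = 0) (i j : Fin 3) :
    torus u hu i j = if i = j then 2 ^ u i else 0 :=
  Matrix.diagonal_apply ..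

theorem torus_inv (u : Fin 3 → ℤ) (hu : ∑ i, u i = 0) :
    (torus u hu)⁻¹ = torus (-u) (by simp [hu]) := by
  rw [inv_eq_iff_mul_eq_one]
  apply Subtype.ext
  rw [Matrix.SpecialLinearGroup.coe_mul, torus, torus, Matrix.diagonal_mul_diagonal,
    Matrix.SpecialLinearGroup.coe_one, ← Matrix.diagonal_one]
  congr 1
  ext i
  rw [Pi.neg_apply, ← zpow_add₀ two_ne_zero, add_neg_cancel, zpow_zero]

variable {e : Basis (Fin 3) ℂ (Dual ℂ E)} {f : Basis (Fin 3) ℂ (Dual ℂ F)}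
  {g : SpecialLinearGroup ℂ E} {h : SpecialLinearGroup ℂ F} {u v : Fin 3 → ℤ}
  {hu : ∑ i, u i = 0} {hv : ∑ i, v i = 0}

theorem polyAction_torus_ME (hg : TransformsBy e g (torus u hu))
    (hh : TransformsBy f h (torus v hv)) (i j : Fin 3) :
    polyAction (g, h) (ME e f i j) = (2 ^ (v j - u i) : ℂ) • ME e f i j := by
  rw [hg.polyAction_ME hh, torus_inv]
  simp only [torus_apply, Pi.neg_apply]
  rw [Finset.sum_eq_single i, Finset.sum_eq_single j]
  · rw [if_pos rfl, if_pos rfl, ← zpow_add₀ two_ne_zero, neg_add_eq_sub]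
  · intro l _ hl
    rw [if_neg hl.symm, mul_zero, zero_smul]
  · exact fun hj => absurd (Finset.mem_univ j) hj
  · intro k _ hk
    exact Finset.sum_eq_zero fun l _ => by rw [if_neg hk, zero_mul, zero_smul]
  · exact fun hi => absurd (Finset.mem_univ i) hi

theorem polyAction_torus_MF (hg : TransformsBy e g (torus u hu))
    (hh : TransformsBy f h (torus v hv)) (i j : Fin 3) :
    polyAction (g, h) (MF e f i j) = (2 ^ (u i - v j) : ℂ) • MF e f i j := by
  rw [hg.polyAction_MF hh, torus_inv]
  simp only [torus_apply, Pi.neg_apply]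
  rw [Finset.sum_eq_single i, Finset.sum_eq_single j]
  · rw [if_pos rfl, if_pos rfl, ← zpow_add₀ two_ne_zero, sub_eq_add_neg]
  · intro l _ hl
    rw [if_neg hl, mul_zero, zero_smul]
  · exact fun hj => absurd (Finset.mem_univ j) hj
  · intro k _ hk
    exact Finset.sum_eq_zero fun l _ => by rw [if_neg hk.symm, zero_mul, zero_smul]
  · exact fun hi => absurd (Finset.mem_univ i) hi

/-- The exponent of the character by which `(torus u, torus v)` acts on a monomial. -/
def weight (u v : Fin 3 → ℤ) (s t : List (Fin 3 × Fin 3)) : ℤ :=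
  (s.map fun x => v x.2 - u x.1).sum + (t.map fun x => u x.1 - v x.2).sum

theorem prod_map_smul {ι A : Type*} [CommRing A] [Algebra ℂ A] (w : ι → ℤ) (m : ι → A)
    (l : List ι) : (l.map fun x => (2 ^ w x : ℂ) • m x).prod =
      (2 ^ (l.map w).sum : ℂ) • (l.map m).prod := by
  induction l with
  | nil => simp
  | cons x l ih =>
    simp only [List.map_cons, List.prod_cons, List.sum_cons, ih, zpow_add₀ (two_ne_zero (α := ℂ)),
      smul_mul_smul_comm]

theorem polyAction_torus_monomial (hg : TransformsBy e g (torus u hu))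
    (hh : TransformsBy f h (torus v hv)) (a b : ℕ) (s t : List (Fin 3 × Fin 3)) :
    polyAction (g, h) (monomial e f a b s t) =
      (2 ^ weight u v s t : ℂ) • monomial e f a b s t := by
  simp only [monomial, map_mul, map_pow, hg.polyAction_LE, hh.polyAction_LF, map_list_prod,
    List.map_map, Function.comp_def, polyAction_torus_ME hg hh, polyAction_torus_MF hg hh]
  rw [prod_map_smul (fun x : Fin 3 × Fin 3 => v x.2 - u x.1),
    prod_map_smul (fun x : Fin 3 × Fin 3 => u x.1 - v x.2), weight, zpow_add₀ two_ne_zero,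
    mul_smul_comm, mul_smul_comm, smul_mul_assoc, smul_smul, mul_comm (_ ^ _)]

theorem two_zpow_eq_one {n : ℤ} (hn : (2 ^ n : ℂ) = 1) : n = 0 := by
  have h : (2 ^ n : ℝ) = 1 := by
    have h' : ((2 ^ n : ℝ) : ℂ) = 1 := by push_cast; exact hn
    exact_mod_cast h'
  exact (zpow_eq_one_iff_right₀ (by norm_num) (by norm_num)).1 h

theorem eq_one_of_smul_eq_self {V : Type*} [AddCommGroup V] [Module ℂ V] {c : ℂ} {x : V}
    (hx : x ≠ 0) (hc : c • x = x) : c = 1 := by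
  have hc' : (c - 1) • x = 0 := by rw [sub_smul, hc, one_smul, sub_self]
  exact sub_eq_zero.1 ((smul_eq_zero.1 hc').resolve_right hx)

/-- A weight that separates the torus-invariant monomials of degree at most three. -/
def testWeight : Fin 3 → ℤ := ![1, 4, -5]

theorem sum_testWeight : ∑ i, testWeight i = 0 := by decide

theorem sum_zero_fin_three : ∑ i, (0 : Fin 3 → ℤ) i = 0 := by decide

/-- Since 2 is not a root of unity, one diagonal element in each factor detects its weight exactly:
the first filters by row indices, the second by column indices. -/
theorem mem_span_weight_zero (hE : finrank ℂ E = 3) (hF : finrank ℂ F = 3)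
    (e : Basis (Fin 3) ℂ (Dual ℂ E)) (f : Basis (Fin 3) ℂ (Dual ℂ F))
    {p : PolyRing (Trivectors E F)} (hp : p ∈ degreeLE (Trivectors E F) 3)
    (hinv : ∀ g, polyAction g p = p) :
    p ∈ Submodule.span ℂ {q | ∃ a b s t, a + b + s.length + t.length ≤ 3 ∧
      weight testWeight 0 s t = 0 ∧ weight 0 testWeight s t = 0 ∧
        monomial e f a b s t = q} := by
  obtain ⟨g₁, hg₁⟩ := exists_transformsBy hE e (torus testWeight sum_testWeight)
  obtain ⟨g₀, hg₀⟩ := exists_transformsBy hE e (torus 0 sum_zero_fin_three)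
  obtain ⟨h₁, hh₁⟩ := exists_transformsBy hF f (torus testWeight sum_testWeight)
  obtain ⟨h₀, hh₀⟩ := exists_transformsBy hF f (torus 0 sum_zero_fin_three)
  have hp' := degreeLE_le_span_monomials e f hE hF 3 hp
  have hmon : ∀ q ∈ ⋃ k ≤ 3, monomials e f k,
      ∃ a b s t, a + b + s.length + t.length ≤ 3 ∧ monomial e f a b s t = q := by
    intro q hq
    simp only [Set.mem_iUnion] at hq
    obtain ⟨k, hk, a, b, s, t, hn, rfl⟩ := hq
    exact ⟨a, b, s, t, by omega, rfl⟩
  replace hp' := mem_span_fixed (polyAction (g₁, h₀)).toLinearMap (fun q hq => by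
    obtain ⟨a, b, s, t, -, rfl⟩ := hmon q hq
    exact ⟨_, polyAction_torus_monomial hg₁ hh₀ a b s t⟩) hp' (hinv _)
  replace hp' := mem_span_fixed (polyAction (g₀, h₁)).toLinearMap (fun q hq => by
    obtain ⟨a, b, s, t, -, rfl⟩ := hmon q hq.1
    exact ⟨_, polyAction_torus_monomial hg₀ hh₁ a b s t⟩) hp' (hinv _)
  refine (Submodule.span_le.2 ?_) hp'
  rintro q ⟨⟨hq, hq₁⟩, hq₂⟩
  obtain ⟨a, b, s, t, hn, rfl⟩ := hmon q hq
  -- A vanishing monomial is fixed whatever its weight, so it must be treated apart.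
  by_cases hzero : monomial e f a b s t = 0
  · rw [hzero]; exact Submodule.zero_mem _
  rw [AlgHom.toLinearMap_apply, polyAction_torus_monomial hg₁ hh₀] at hq₁
  rw [AlgHom.toLinearMap_apply, polyAction_torus_monomial hg₀ hh₁] at hq₂
  exact Submodule.subset_span ⟨a, b, s, t, hn,
    two_zpow_eq_one (eq_one_of_smul_eq_self hzero hq₁),
    two_zpow_eq_one (eq_one_of_smul_eq_self hzero hq₂), rfl⟩

/-- The exponents of a monomial of degree at most three which is fixed by the diagonal matrices. -/
theorem weight_zero_cases {s t : List (Fin 3 × Fin 3)} (hn : s.length + t.length ≤ 3)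
    (h₁ : weight testWeight 0 s t = 0) (h₂ : weight 0 testWeight s t = 0) :
    (s = [] ∧ t = []) ∨ (∃ x, s = [x] ∧ t = [x]) ∨
      (∃ σ τ : Equiv.Perm (Fin 3), s = [(σ 0, τ 0), (σ 1, τ 1), (σ 2, τ 2)] ∧ t = []) ∨
      (∃ σ τ : Equiv.Perm (Fin 3), s = [] ∧ t = [(σ 0, τ 0), (σ 1, τ 1), (σ 2, τ 2)]) := by
  -- The values 1, 4, -5 are chosen for these five facts: apart from their total and the equality of
  -- two equal values, no relation with at most three terms of the relevant shapes holds.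
  have hperm : ∀ x y z : Fin 3, testWeight x + testWeight y + testWeight z = 0 →
      ∃ σ : Equiv.Perm (Fin 3), σ 0 = x ∧ σ 1 = y ∧ σ 2 = z := by decide
  have hone : ∀ x y : Fin 3, testWeight x = testWeight y → x = y := by decide
  have hne₁ : ∀ x : Fin 3, testWeight x ≠ 0 := by decide
  have hne₂ : ∀ x y : Fin 3, testWeight x + testWeight y ≠ 0 := by decide
  have hne₃ : ∀ x y z : Fin 3, testWeight x + testWeight y - testWeight z ≠ 0 := by decide
  rcases s with _ | ⟨x, _ | ⟨y, _ | ⟨z, _ | ⟨w, s⟩⟩⟩⟩ <;>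
    rcases t with _ | ⟨x', _ | ⟨y', _ | ⟨z', _ | ⟨w', t⟩⟩⟩⟩ <;>
    simp only [List.length_cons, List.length_nil] at hn <;> try omega
  all_goals
    simp only [weight, List.map_cons, List.map_nil, List.sum_cons, List.sum_nil,
      Pi.zero_apply] at h₁ h₂
  · exact Or.inl ⟨rfl, rfl⟩
  · exact absurd (by linarith) (hne₁ x'.1)
  · exact absurd (by linarith) (hne₂ x'.1 y'.1)
  · obtain ⟨σ, h0, h1, h2⟩ := hperm x'.1 y'.1 z'.1 (by linarith)
    obtain ⟨τ, k0, k1, k2⟩ := hperm x'.2 y'.2 z'.2 (by linarith)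
    exact Or.inr (Or.inr (Or.inr ⟨σ, τ, rfl, by rw [h0, h1, h2, k0, k1, k2]⟩))
  · exact absurd (by linarith) (hne₁ x.1)
  · refine Or.inr (Or.inl ⟨x, rfl, ?_⟩)
    rw [Prod.ext (hone x'.1 x.1 (by linarith)) (hone x'.2 x.2 (by linarith))]
  · exact absurd (by linarith) (hne₃ x'.1 y'.1 x.1)
  · exact absurd (by linarith) (hne₂ x.1 y.1)
  · exact absurd (by linarith) (hne₃ x.1 y.1 x'.1)
  · obtain ⟨σ, h0, h1, h2⟩ := hperm x.1 y.1 z.1 (by linarith)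
    obtain ⟨τ, k0, k1, k2⟩ := hperm x.2 y.2 z.2 (by linarith)
    exact Or.inr (Or.inr (Or.inl ⟨σ, τ, by rw [h0, h1, h2, k0, k1, k2], rfl⟩))

end Torus

/-! ### Signed permutation matrices -/

section SignedPermutations

open Equiv (Perm)

variable {E F : Type*} [AddCommGroup E] [Module ℂ E] [AddCommGroup F] [Module ℂ F]

/-- The permutation matrix of `σ` multiplied by the sign of `σ`. -/
def signedPerm (σ : Perm (Fin 3)) : Matrix.SpecialLinearGroup (Fin 3) ℂ :=
  ⟨((Perm.sign σ : ℤ) : ℂ) • σ.permMatrix ℂ, by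
    -- The size 3 is odd, so the determinant is the cube of the sign times the sign, which is 1.
    rw [Matrix.det_smul, Matrix.det_permutation, Fintype.card_fin]
    rcases Int.units_eq_one_or (Perm.sign σ) with h | h <;> norm_num [h]⟩

theorem signedPerm_apply (σ : Perm (Fin 3)) (i j : Fin 3) :
    signedPerm σ i j = if σ i = j then ((Perm.sign σ : ℤ) : ℂ) else 0 := by
  change ((Perm.sign σ : ℤ) : ℂ) * σ.permMatrix ℂ i j = _
  simp [Perm.permMatrix, PEquiv.toMatrix_apply, eq_comm]

theorem sign_mul_sign (σ : Perm (Fin 3)) :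
    ((Perm.sign σ : ℤ) : ℂ) * ((Perm.sign σ : ℤ) : ℂ) = 1 := by
  rcases Int.units_eq_one_or (Perm.sign σ) with h | h <;> norm_num [h]

theorem signedPerm_inv_apply (σ : Perm (Fin 3)) (i j : Fin 3) :
    (signedPerm σ)⁻¹ i j = if i = σ j then ((Perm.sign σ : ℤ) : ℂ) else 0 := by
  have h : (signedPerm σ)⁻¹ = signedPerm σ⁻¹ := by
    rw [inv_eq_iff_mul_eq_one]
    ext i j
    rw [Matrix.SpecialLinearGroup.coe_mul, Matrix.mul_apply, Finset.sum_eq_single (σ i)]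
    · simp [signedPerm_apply, Matrix.one_apply, sign_mul_sign]
    · intro k _ hk
      rw [signedPerm_apply, if_neg hk.symm, zero_mul]
    · exact fun hi => absurd (Finset.mem_univ _) hi
  rw [h, signedPerm_apply, Perm.sign_inv]
  simp only [Perm.inv_eq_iff_eq]

variable {e : Basis (Fin 3) ℂ (Dual ℂ E)} {f : Basis (Fin 3) ℂ (Dual ℂ F)}
  {g : SpecialLinearGroup ℂ E} {h : SpecialLinearGroup ℂ F} {σ τ : Perm (Fin 3)}

theorem polyAction_signedPerm_ME (hg : TransformsBy e g (signedPerm σ))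
    (hh : TransformsBy f h (signedPerm τ)) (i j : Fin 3) :
    polyAction (g, h) (ME e f i j) =
      (((Perm.sign σ : ℤ) : ℂ) * ((Perm.sign τ : ℤ) : ℂ)) • ME e f (σ i) (τ j) := by
  rw [hg.polyAction_ME hh]
  simp only [signedPerm_apply, signedPerm_inv_apply]
  rw [Finset.sum_eq_single (σ i), Finset.sum_eq_single (τ j)]
  · rw [if_pos rfl, if_pos rfl]
  · intro l _ hl
    rw [if_neg hl.symm, mul_zero, zero_smul]
  · exact fun hj => absurd (Finset.mem_univ _) hj
  · intro k _ hk
    exact Finset.sum_eq_zero fun l _ => by rw [if_neg hk, zero_mul, zero_smul]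
  · exact fun hi => absurd (Finset.mem_univ _) hi

theorem polyAction_signedPerm_MF (hg : TransformsBy e g (signedPerm σ))
    (hh : TransformsBy f h (signedPerm τ)) (i j : Fin 3) :
    polyAction (g, h) (MF e f i j) =
      (((Perm.sign σ : ℤ) : ℂ) * ((Perm.sign τ : ℤ) : ℂ)) • MF e f (σ i) (τ j) := by
  rw [hg.polyAction_MF hh]
  simp only [signedPerm_apply, signedPerm_inv_apply]
  rw [Finset.sum_eq_single (σ i), Finset.sum_eq_single (τ j)]
  · rw [if_pos rfl, if_pos rfl]
  · intro l _ hl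
    rw [if_neg hl, mul_zero, zero_smul]
  · exact fun hj => absurd (Finset.mem_univ _) hj
  · intro k _ hk
    exact Finset.sum_eq_zero fun l _ => by rw [if_neg hk.symm, zero_mul, zero_smul]
  · exact fun hi => absurd (Finset.mem_univ _) hi

/-- Each value `k` is taken at `i` by exactly (3 - 1)! = 2 permutations. -/
theorem sum_perm_apply {A : Type*} [AddCommMonoid A] (G : Fin 3 → A) (i : Fin 3) :
    ∑ σ : Perm (Fin 3), G (σ i) = 2 • ∑ k, G k := by
  have himage : ∀ i : Fin 3, Finset.univ.image (fun σ : Perm (Fin 3) => σ i) = Finset.univ := by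
    decide
  have hcard : ∀ i k : Fin 3, (Finset.univ.filter fun σ : Perm (Fin 3) => σ i = k).card = 2 := by
    decide
  rw [Finset.sum_comp G (fun σ : Perm (Fin 3) => σ i), himage, Finset.smul_sum]
  exact Finset.sum_congr rfl fun k _ => by rw [hcard]

/-- Reindexing the product by `β` gives the Leibniz expansion of `M` with rows permuted by `α *
β⁻¹`. -/
theorem sum_sign_mul_prod {n A : Type*} [Fintype n] [DecidableEq n] [CommRing A]
    (M : Matrix n n A) (α β : Perm n) :
    ∑ τ : Perm n, ((Perm.sign τ : ℤ) : A) * ∏ k, M (α k) (τ (β k)) =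
      ((Perm.sign (α * β⁻¹) : ℤ) : A) * M.det := by
  rw [← Matrix.det_permute, ← Matrix.det_transpose, Matrix.det_apply']
  refine Finset.sum_congr rfl fun τ _ => ?_
  conv_rhs => rw [← Equiv.prod_comp β]
  simp

/-- The sum of the images of `p` under pairs of signed permutations. -/
def permSum (g : Perm (Fin 3) → SpecialLinearGroup ℂ E) (h : Perm (Fin 3) → SpecialLinearGroup ℂ F) :
    PolyRing (Trivectors E F) →ₗ[ℂ] PolyRing (Trivectors E F) :=
  ∑ σ, ∑ τ, (polyAction (g σ, h τ)).toLinearMap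

theorem permSum_apply (g : Perm (Fin 3) → SpecialLinearGroup ℂ E)
    (h : Perm (Fin 3) → SpecialLinearGroup ℂ F) (p : PolyRing (Trivectors E F)) :
    permSum g h p = ∑ σ, ∑ τ, polyAction (g σ, h τ) p := by
  simp [permSum, LinearMap.sum_apply]

variable {g : Perm (Fin 3) → SpecialLinearGroup ℂ E} {h : Perm (Fin 3) → SpecialLinearGroup ℂ F}

theorem permSum_mul_of_fixed {p q : PolyRing (Trivectors E F)}
    (hp : ∀ σ τ, polyAction (g σ, h τ) p = p) : permSum g h (p * q) = p * permSum g h q := by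
  simp only [permSum_apply, map_mul, hp, Finset.mul_sum]

theorem permSum_of_fixed {p : PolyRing (Trivectors E F)}
    (hp : ∀ σ τ, polyAction (g σ, h τ) p = p) : permSum g h p = (36 : ℂ) • p := by
  simp only [permSum_apply, hp, Finset.sum_const, Finset.card_univ, Fintype.card_perm,
    Fintype.card_fin, smul_smul, ← Nat.cast_smul_eq_nsmul ℂ]
  norm_num [Nat.factorial]

/-- The signs from the two factors cancel, and each entry of the trace occurs 2 · 2 = 4 times. -/
theorem permSum_ME_mul_MF (hg : ∀ σ, TransformsBy e (g σ) (signedPerm σ))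
    (hh : ∀ τ, TransformsBy f (h τ) (signedPerm τ)) (i j : Fin 3) :
    permSum g h (ME e f i j * MF e f i j) = (4 : ℕ) • (ME e f * (MF e f).transpose).trace := by
  have hsign : ∀ σ τ : Perm (Fin 3), (((Perm.sign σ : ℤ) : ℂ) * ((Perm.sign τ : ℤ) : ℂ)) *
      (((Perm.sign σ : ℤ) : ℂ) * ((Perm.sign τ : ℤ) : ℂ)) = 1 := fun σ τ => by
    rw [mul_mul_mul_comm, sign_mul_sign, sign_mul_sign, one_mul]
  simp only [permSum_apply, map_mul, polyAction_signedPerm_ME (hg _) (hh _),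
    polyAction_signedPerm_MF (hg _) (hh _), smul_mul_smul_comm, hsign, one_smul]
  rw [sum_perm_apply (fun i' => ∑ τ : Perm (Fin 3), ME e f i' (τ j) * MF e f i' (τ j)) i]
  simp only [fun i' => sum_perm_apply (fun j' => ME e f i' j' * MF e f i' j') j,
    ← Finset.smul_sum, smul_smul]
  rfl

/-- Three factors contribute the cube of a sign, which is that sign again. The sum over `τ` is then
already a determinant up to sign, and the sum over `σ` only changes the scalar. -/
theorem permSum_prod {M : Matrix (Fin 3) (Fin 3) (PolyRing (Trivectors E F))}
    (hM : ∀ σ τ i j, polyAction (g σ, h τ) (M i j) =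
      (((Perm.sign σ : ℤ) : ℂ) * ((Perm.sign τ : ℤ) : ℂ)) • M (σ i) (τ j)) (α β : Perm (Fin 3)) :
    ∃ c : ℂ, permSum g h (∏ k, M (α k) (β k)) = c • M.det := by
  have hcube : ∀ σ τ : Perm (Fin 3), (((Perm.sign σ : ℤ) : ℂ) * ((Perm.sign τ : ℤ) : ℂ)) ^ 3 =
      ((Perm.sign σ : ℤ) : ℂ) * ((Perm.sign τ : ℤ) : ℂ) := fun σ τ => by
    rw [mul_pow, pow_succ, pow_two, sign_mul_sign, one_mul, pow_succ, pow_two, sign_mul_sign,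
      one_mul]
  refine ⟨∑ σ : Perm (Fin 3), ((Perm.sign σ : ℤ) : ℂ) * ((Perm.sign (σ * α * β⁻¹) : ℤ) : ℂ), ?_⟩
  rw [permSum_apply, Finset.sum_smul]
  refine Finset.sum_congr rfl fun σ _ => ?_
  have hdet := sum_sign_mul_prod M (σ * α) β
  rw [mul_smul, Algebra.smul_def (Int.cast _) M.det, map_intCast, ← hdet, Finset.smul_sum]
  refine Finset.sum_congr rfl fun τ _ => ?_
  rw [map_prod]
  simp only [hM, Fin.prod_univ_three, Perm.mul_apply]
  rw [smul_mul_smul_comm, smul_mul_smul_comm, ← pow_two, ← pow_succ, hcube, mul_smul,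
    Algebra.smul_def ((Perm.sign τ : ℤ) : ℂ), map_intCast]

/-- An invariant polynomial of degree at most three is generated by the basic invariants. -/
theorem mem_adjoin_of_invariant (hE : finrank ℂ E = 3) (hF : finrank ℂ F = 3)
    (e : Basis (Fin 3) ℂ (Dual ℂ E)) (f : Basis (Fin 3) ℂ (Dual ℂ F))
    {p : PolyRing (Trivectors E F)} (hp : p ∈ degreeLE (Trivectors E F) 3)
    (hinv : ∀ g, polyAction g p = p) : p ∈ Algebra.adjoin ℂ (basicInvariants e f) := by
  choose g hg using fun σ => exists_transformsBy hE e (signedPerm σ)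
  choose h hh using fun τ => exists_transformsBy hF f (signedPerm τ)
  set A := Algebra.adjoin ℂ (basicInvariants e f) with hA
  have hLE : LE F e ∈ A := Algebra.subset_adjoin (by simp [basicInvariants])
  have hLF : LF E f ∈ A := Algebra.subset_adjoin (by simp [basicInvariants])
  have htr : (ME e f * (MF e f).transpose).trace ∈ A :=
    Algebra.subset_adjoin (by simp [basicInvariants])
  have hdE : (ME e f).det ∈ A := Algebra.subset_adjoin (by simp [basicInvariants])
  have hdF : (MF e f).det ∈ A := Algebra.subset_adjoin (by simp [basicInvariants])
  have hsum : permSum g h p ∈ A := by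
    suffices hle : Submodule.span ℂ _ ≤ A.toSubmodule.comap (permSum g h) from
      hle (mem_span_weight_zero hE hF e f hp hinv)
    rw [Submodule.span_le]
    rintro _ ⟨a, b, s, t, hn, h₁, h₂, rfl⟩
    change permSum g h (monomial e f a b s t) ∈ A
    rw [monomial, mul_assoc, permSum_mul_of_fixed fun σ τ => by
      rw [map_mul, map_pow, map_pow, (hg σ).polyAction_LE, (hh τ).polyAction_LF]]
    refine A.mul_mem (A.mul_mem (A.pow_mem hLE a) (A.pow_mem hLF b)) ?_
    rcases weight_zero_cases (by omega) h₁ h₂ with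
      ⟨rfl, rfl⟩ | ⟨x, rfl, rfl⟩ | ⟨α, β, rfl, rfl⟩ | ⟨α, β, rfl, rfl⟩
    · rw [List.map_nil, List.map_nil, List.prod_nil, one_mul,
        permSum_of_fixed fun σ τ => map_one _]
      exact A.smul_mem A.one_mem _
    · simp only [List.map_cons, List.map_nil, List.prod_singleton]
      rw [permSum_ME_mul_MF hg hh]
      exact A.nsmul_mem htr 4
    · obtain ⟨c, hc⟩ := permSum_prod (g := g) (h := h) (M := ME e f)
        (fun σ τ => polyAction_signedPerm_ME (hg σ) (hh τ)) α β
      rw [Fin.prod_univ_three] at hc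
      simp only [List.map_cons, List.map_nil, List.prod_cons, List.prod_nil, mul_one, ← mul_assoc]
      rw [hc]
      exact A.smul_mem hdE c
    · obtain ⟨c, hc⟩ := permSum_prod (g := g) (h := h) (M := MF e f)
        (fun σ τ => polyAction_signedPerm_MF (hg σ) (hh τ)) α β
      rw [Fin.prod_univ_three] at hc
      simp only [List.map_cons, List.map_nil, List.prod_cons, List.prod_nil, mul_one, one_mul,
        ← mul_assoc]
      rw [hc]
      exact A.smul_mem hdF c
  -- Invariance of `p` makes its sum over all pairs equal to `36 • p`; dividing by 36 finishes.
  rw [permSum_of_fixed fun σ τ => hinv _] at hsum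
  have hp36 := A.smul_mem hsum (36 : ℂ)⁻¹
  rwa [smul_smul, inv_mul_cancel₀ (by norm_num), one_smul] at hp36

end SignedPermutations

end

end TrivectorInvariants

theorem theorem5p2 {E F : Type*} [AddCommGroup E] [Module ℂ E] [AddCommGroup F] [Module ℂ F]
    (hE : Module.finrank ℂ E = 3) (hF : Module.finrank ℂ F = 3)
    (e : Module.Basis (Fin 3) ℂ (Module.Dual ℂ E)) (f : Module.Basis (Fin 3) ℂ (Module.Dual ℂ F)) :
    TrivectorInvariants.basicInvariants e f ⊆ TrivectorInvariants.invariantRing E F ∧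
    ∀ p ∈ TrivectorInvariants.degreeLE (TrivectorInvariants.Trivectors E F) 3,
      p ∈ TrivectorInvariants.invariantRing E F ↔
        p ∈ Algebra.adjoin ℂ (TrivectorInvariants.basicInvariants e f) := by
  have hsub := TrivectorInvariants.basicInvariants_subset_invariantRing hE hF e f
  refine ⟨hsub, fun p hp => ⟨fun hinv => ?_, fun h => Algebra.adjoin_le hsub h⟩⟩
  rw [TrivectorInvariants.invariantRing, Algebra.mem_iInf] at hinv
  exact TrivectorInvariants.mem_adjoin_of_invariant hE hF e f hp hinv
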